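/- **Corollary (Non-centred strong LLN).** Let $\{X_k(m): m\in[0,\infty),\ k\in\mathbb N\}$, $\mathbb N=\{1,2,\dots\}$, be a family of integrable real random variables on a probability space $(\Omega,\mathcal F,\mathbb P)$ that is independent in $k$: for every choice of $(m_k)_k\in[0,\infty)^{\mathbb N}$ the variables $X_1(m_1),X_2(m_2),\dots$ are independent (this holds in particular if the processes $(X_k(m))_{m\ge0}$, $k\in\mathbb N$, are independent). For a family $\{Y_k(m)\}$ consider the conditions - **(S1)** There is a $\delta>0$ such that for all $\varepsilon>0$ there is a $C=C(\varepsilon)$ with $\sup_k\mathbb P(|Y_k(m)|>\varepsilon)<C/m^{\delta}$ for all $m>0$. - **(S2)** There are a random variable $X_*$ and a $\gamma>0$ with $\mathbb E(|X_*|^{2+\gamma})<\infty$ and $\sup_{k\in\mathbb N,\,m\ge0}\mathbb P(|Y_k(m)|>x)\le\mathbb P(X_*>x)$ for all $x\in\mathbb R$. - **(S3)** For every $\varepsilon>0$ there are $\beta>1$ and $C_\varepsilon>0$ such that for all $t,r>0$ and $m\ge0$ $$\sup_k\mathbb P\Big(\sup_{0\le s\le m}\big|(r+s)Y_k(r+s)-rY_k(r)\big|\ge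 t\varepsilon\Big)\le\frac{C_\varepsilon m^\beta}{t^\beta},$$ where $\mathbb P$ denotes outer measure if the event is not measurable. Assume that (S1)–(S3) hold for $Y_k(m)=X_k(m)$, or that they hold for the centred family $Y_k(m)=X_k(m)-\mathbb E[X_k(m)]$. Let $(m_k)_{k\in\mathbb N}\subset[0,\infty)$ satisfy $\sum_k m_k=\infty$, put $M_n=\sum_{k=1}^n m_k$ (with $M_0=0$), and for $t>0$ let $\ell_t=\inf\{\ell\in\mathbb N: M_\ell\ge t\}$, $\bar t=t-M_{\ell_t-1}$ and $$\mathcal S_t=\sum_{k=1}^{\ell_t-1}\frac{m_k}{t}X_k(m_k)+\frac{\bar t}{t}X_{\ell_t}(\bar t).$$ Then, for every non-decreasing real sequence $(t_k)_{k\in\mathbb N}$ with $\lim_k t_k=\infty$ for which $\lim_k\mathbb E[\mathcal S_{t_k}]=v\in\mathbb R$ exists, $$\mathbb P\Big(\lim_{k\to\infty}\mathcal S_{t_k}=v\Big)=1.$$ -/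

import Mathlib

open MeasureTheory ProbabilityTheory Filter Topology

/-!
Indices start at `0`: the variable `X k` and the mass `m k` are the objects with number `k + 1`
in the usual enumeration `1, 2, 3, …`.  A family `X : ℕ → ℝ → Ω → ℝ` is only ever used, and only
ever constrained, at parameters `m ≥ 0`.
-/

namespace GameOfMass

noncomputable section

variable {Ω : Type*} [MeasurableSpace Ω]

/-- (S1), polynomial decay. At `m = 0` the bound `C / m ^ δ` is `+∞`, hence no condition. -/
def PolynomialDecay (X : ℕ → ℝ → Ω → ℝ) (P : Measure Ω) : Prop :=
  ∃ δ : ℝ, 0 < δ ∧ ∀ ε : ℝ, 0 < ε → ∃ C : ℝ, ∀ m : ℝ, 0 < m →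
    ⨆ k : ℕ, P {ω | ε < |X k m ω|} < ENNReal.ofReal (C / m ^ δ)

/-- (S2), stochastic domination (of the absolute values) by a random variable `Xs` with a finite
moment of order `2 + γ`. -/
def StochasticDomination (X : ℕ → ℝ → Ω → ℝ) (P : Measure Ω) : Prop :=
  ∃ (Xs : Ω → ℝ) (γ : ℝ), Measurable Xs ∧ 0 < γ ∧
    Integrable (fun ω => |Xs ω| ^ (2 + γ)) P ∧
    ∀ x : ℝ, ⨆ (k : ℕ) (m : ℝ) (_ : 0 ≤ m), P {ω | x < |X k m ω|} ≤ P {ω | x < Xs ω}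

/-- (S3), slow relative increment growth. The supremum over `s ∈ [0, m]` is taken in `[0, ∞]`;
`P` of a set that is not measurable is its outer measure. -/
def SlowIncrementGrowth (X : ℕ → ℝ → Ω → ℝ) (P : Measure Ω) : Prop :=
  ∀ ε : ℝ, 0 < ε → ∃ β C : ℝ, 1 < β ∧ 0 < C ∧ ∀ t r m : ℝ, 0 < t → 0 < r → 0 ≤ m →
    ⨆ k : ℕ, P {ω | ENNReal.ofReal (t * ε) ≤ ⨆ s ∈ Set.Icc (0 : ℝ) m,
        ENNReal.ofReal |(r + s) * X k (r + s) ω - r * X k r ω|}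
      ≤ ENNReal.ofReal (C * m ^ β / t ^ β)

/-- The conjunction of (S1), (S2) and (S3). -/
def SatisfiesS (X : ℕ → ℝ → Ω → ℝ) (P : Measure Ω) : Prop :=
  PolynomialDecay X P ∧ StochasticDomination X P ∧ SlowIncrementGrowth X P

/-- The centred family `X_k(m) - E[X_k(m)]`. -/
def centred (X : ℕ → ℝ → Ω → ℝ) (P : Measure Ω) : ℕ → ℝ → Ω → ℝ :=
  fun k m ω => X k m ω - ∫ ω', X k m ω' ∂P

/-- `M_n`, the sum of the first `n` masses; `M_0 = 0`. -/
def cumMass (m : ℕ → ℝ) (n : ℕ) : ℝ := ∑ k ∈ Finset.range n, m k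

/-- The (zero-based) index of the increment that contains time `t`, that is `ℓ_t - 1` with
`ℓ_t = inf {ℓ ≥ 1 : M_ℓ ≥ t}`. -/
def lastIndex (m : ℕ → ℝ) (t : ℝ) : ℕ := sInf {n : ℕ | t ≤ cumMass m (n + 1)}

/-- `t - M_{ℓ_t - 1}`, the time spent in the last, uncompleted increment. -/
def remTime (m : ℕ → ℝ) (t : ℝ) : ℝ := t - cumMass m (lastIndex m t)

/-- The gradual sum
`𝒮_t = ∑_{k < ℓ_t} (m_k / t) X_k(m_k) + (t̄ / t) X_{ℓ_t}(t̄)`, with `t̄ = remTime m t`. -/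
def gradualSum (X : ℕ → ℝ → Ω → ℝ) (m : ℕ → ℝ) (t : ℝ) (ω : Ω) : ℝ :=
  ∑ k ∈ Finset.range (lastIndex m t), m k / t * X k (m k) ω
    + remTime m t / t * X (lastIndex m t) (remTime m t) ω

end

end GameOfMass

namespace GameOfMass

/-! The three hypotheses enter only through the bounds in `UniformBounds`, which survive centring
(`UniformBounds.centred`). It therefore suffices that the gradual sums of the centred family tend to
`0` almost surely as real `t → ∞`. Adding the convergent means gives the limit `v`.

Completed increments: with `M` the cumulative mass up to and including `m k`, split according to
whether `m k ≤ M ^ (1 - d)`. Small masses satisfy `(m k / M) ^ 2 ≤ m k * M ^ (-(1 + d))`, which is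
summable, so Kolmogorov's theorem and Kronecker's lemma apply. For large masses the polynomial decay
yields summable tail probabilities. Borel–Cantelli makes these terms a null sequence, and weighted
averages preserve that.

Last increment: it is controlled at times of polynomial growth by decay or Chebyshev, and between
consecutive such times by the increment bound. Since `β > 1`, the increment bounds of all the pieces
of an interval add up to a bound of the same form for the whole interval. -/

/-! ### Deterministic summation -/

/-- Weighted Cesàro averages of a null sequence tend to zero. -/
theorem tendsto_weighted_average_zero {m u : ℕ → ℝ} (hm : ∀ k, 0 ≤ m k)
    (hdiv : Tendsto (cumMass m) atTop atTop) (hu : Tendsto u atTop (𝓝 0)) :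
    Tendsto (fun n => (∑ k ∈ Finset.range n, m k * u k) / cumMass m n) atTop (𝓝 0) := by
  have h : (fun k => m k * u k) =o[atTop] m := by
    have := (Asymptotics.isBigO_refl m atTop).mul_isLittleO
      ((Asymptotics.isLittleO_one_iff ℝ).2 hu)
    simpa using this
  exact (h.sum_range hm hdiv).tendsto_div_nhds_zero

theorem cumMass_succ (m : ℕ → ℝ) (n : ℕ) : cumMass m (n + 1) = cumMass m n + m n :=
  Finset.sum_range_succ _ _

theorem cumMass_zero (m : ℕ → ℝ) : cumMass m 0 = 0 := Finset.sum_range_zero _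

theorem cumMass_mono {m : ℕ → ℝ} (hm : ∀ k, 0 ≤ m k) : Monotone (cumMass m) :=
  monotone_nat_of_le_succ fun n => by rw [cumMass_succ]; linarith [hm n]

theorem cumMass_nonneg {m : ℕ → ℝ} (hm : ∀ k, 0 ≤ m k) (n : ℕ) : 0 ≤ cumMass m n :=
  Finset.sum_nonneg fun k _ => hm k

/-- Kronecker's lemma for the weights `cumMass m`. -/
theorem kronecker_cumMass {m x : ℕ → ℝ} (hm : ∀ k, 0 ≤ m k)
    (hdiv : Tendsto (cumMass m) atTop atTop) {s : ℝ}
    (hx : Tendsto (fun n => ∑ k ∈ Finset.range n, x k) atTop (𝓝 s)) :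
    Tendsto (fun n => (∑ k ∈ Finset.range n, cumMass m (k + 1) * x k) / cumMass m n)
      atTop (𝓝 0) := by
  set S : ℕ → ℝ := fun n => ∑ k ∈ Finset.range n, x k with hS
  -- Abel summation around the limit `s`, so that both terms on the right are null after division by
  -- the cumulative mass.
  have habel : ∀ n, ∑ k ∈ Finset.range n, cumMass m (k + 1) * x k
      = cumMass m n * (S n - s) - ∑ k ∈ Finset.range n, m k * (S k - s) := by
    intro n
    induction n with
    | zero => simp [cumMass_zero]
    | succ n ih =>
      have h1 : S (n + 1) = S n + x n := Finset.sum_range_succ _ _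
      rw [Finset.sum_range_succ, ih, Finset.sum_range_succ, h1, cumMass_succ]
      ring
  have h0 : Tendsto (fun n => S n - s) atTop (𝓝 0) := by
    simpa using hx.sub_const s
  have h1 := h0.sub (tendsto_weighted_average_zero hm hdiv h0)
  rw [sub_zero] at h1
  refine h1.congr' ?_
  filter_upwards [hdiv.eventually_gt_atTop 0] with n hn
  rw [habel]
  field_simp

/-- Compares a rectangle with the integral of the decreasing function `x ^ (-(1 + η))` over `[a,
b]`. The right side telescopes along the cumulative masses. -/
theorem sub_mul_rpow_le {a b η : ℝ} (ha : 0 < a) (hab : a ≤ b) (hη : 0 < η) :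
    (b - a) * b ^ (-(1 + η)) ≤ (a ^ (-η) - b ^ (-η)) / η := by
  have hb : 0 < b := ha.trans_le hab
  have h1 : b ^ (-(1 + η)) = b ^ (-η) / b := by
    rw [neg_add, add_comm, Real.rpow_add hb, Real.rpow_neg_one]; rfl
  have h2 : a ^ (-η) = b ^ (-η) * (a / b) ^ (-η) := by
    rw [← Real.mul_rpow hb.le (by positivity)]; congr 1; field_simp
  have h3 : 1 + η * (1 - a / b) ≤ (a / b) ^ (-η) := by
    rw [Real.rpow_def_of_pos (by positivity)]
    have := Real.add_one_le_exp (Real.log (a / b) * -η)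
    have := Real.log_le_sub_one_of_pos (show 0 < a / b by positivity)
    nlinarith
  rw [le_div_iff₀ hη, h1, h2]
  have h4 : 0 < b ^ (-η) := by positivity
  calc (b - a) * (b ^ (-η) / b) * η = b ^ (-η) * (η * (1 - a / b)) := by field_simp
    _ ≤ b ^ (-η) * ((a / b) ^ (-η) - 1) := by gcongr; linarith
    _ = _ := by ring

theorem summable_mass_mul_rpow {m : ℕ → ℝ} (hm : ∀ k, 0 ≤ m k)
    (hdiv : Tendsto (cumMass m) atTop atTop) {η : ℝ} (hη : 0 < η) :
    Summable fun k => m k * cumMass m (k + 1) ^ (-(1 + η)) := by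
  -- Leading masses may vanish; the comparison starts once the cumulative mass is positive.
  obtain ⟨N, hN⟩ := (hdiv.eventually_gt_atTop 0).exists
  rw [← summable_nat_add_iff N]
  have hpos : ∀ k, 0 < cumMass m (k + N) := fun k =>
    hN.trans_le (cumMass_mono hm (Nat.le_add_left _ _))
  have hsum : ∀ n, ∑ k ∈ Finset.range n, m (k + N) * cumMass m (k + N + 1) ^ (-(1 + η))
      ≤ (cumMass m N ^ (-η) - cumMass m (n + N) ^ (-η)) / η := by
    intro n
    induction n with
    | zero => simp
    | succ n ih =>
      rw [Finset.sum_range_succ]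
      have h := sub_mul_rpow_le (hpos n) (cumMass_mono hm (Nat.le_succ (n + N))) hη
      rw [Nat.succ_eq_add_one, show cumMass m (n + N + 1) - cumMass m (n + N) = m (n + N) by
        rw [cumMass_succ]; ring] at h
      rw [show n + 1 + N = n + N + 1 by ring]
      calc _ ≤ _ := add_le_add ih h
        _ = _ := by ring
  refine summable_of_sum_range_le (c := cumMass m N ^ (-η) / η) (fun k => ?_) fun n => ?_
  · exact mul_nonneg (hm _) (Real.rpow_nonneg (cumMass_nonneg hm _) _)
  · refine (hsum n).trans ?_
    gcongr
    have := Real.rpow_nonneg (hpos n).le (-η)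
    linarith



/-! ### Locating a time within the increments -/

theorem le_cumMass_lastIndex_succ {m : ℕ → ℝ} (hdiv : Tendsto (cumMass m) atTop atTop) (t : ℝ) : t ≤ cumMass m (lastIndex m t + 1) := by
  have : {n : ℕ | t ≤ cumMass m (n + 1)}.Nonempty :=
    (((tendsto_add_atTop_iff_nat 1).2 hdiv).eventually_ge_atTop t).exists
  exact Nat.sInf_mem this


theorem cumMass_lastIndex_lt {m : ℕ → ℝ} {t : ℝ} (ht : 0 < t) :
    cumMass m (lastIndex m t) < t := by
  rcases h : lastIndex m t with _ | n
  · rwa [cumMass_zero]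
  · by_contra! hn
    have : lastIndex m t ≤ n := Nat.sInf_le hn
    omega

theorem remTime_pos {m : ℕ → ℝ} {t : ℝ} (ht : 0 < t) : 0 < remTime m t :=
  sub_pos.2 (cumMass_lastIndex_lt ht)

theorem remTime_le {m : ℕ → ℝ} (hm : ∀ k, 0 ≤ m k) (t : ℝ) : remTime m t ≤ t :=
  sub_le_self _ (cumMass_nonneg hm _)

theorem lastIndex_eq {m : ℕ → ℝ} (hm : ∀ k, 0 ≤ m k) {t : ℝ} {n : ℕ}
    (h1 : cumMass m n < t) (h2 : t ≤ cumMass m (n + 1)) : lastIndex m t = n := by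
  refine le_antisymm (Nat.sInf_le h2) (le_csInf ⟨n, h2⟩ fun k hk => ?_)
  by_contra! hkn
  exact absurd (h1.trans_le hk) (not_lt.2 (cumMass_mono hm hkn))

theorem tendsto_lastIndex {m : ℕ → ℝ} (hm : ∀ k, 0 ≤ m k)
    (hdiv : Tendsto (cumMass m) atTop atTop) : Tendsto (lastIndex m) atTop atTop := by
  refine tendsto_atTop.2 fun n => ?_
  filter_upwards [eventually_gt_atTop (cumMass m n)] with t ht
  by_contra! h
  exact absurd (ht.trans_le (le_cumMass_lastIndex_succ hdiv t)) (not_lt.2 (cumMass_mono hm h))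

/-! ### Borel–Cantelli and Kolmogorov's one-series theorem -/

variable {Ω : Type*} [MeasurableSpace Ω]

/-- Borel–Cantelli for sets, not necessarily measurable, of eventually summably bounded measure. -/
theorem ae_eventually_notMem_of_le {P : Measure Ω} [IsFiniteMeasure P] {s : ℕ → Set Ω}
    {a : ℕ → ℝ} (ha : Summable a) (hs : ∀ᶠ k in atTop, P (s k) ≤ ENNReal.ofReal (a k)) :
    ∀ᵐ ω ∂P, ∀ᶠ k in atTop, ω ∉ s k := by
  obtain ⟨N, hN⟩ := eventually_atTop.1 hs
  have h := ae_eventually_notMem (μ := P) (s := fun k => s (k + N)) (ne_top_of_le_ne_top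
    ((summable_nat_add_iff N).2 ha).tsum_ofReal_ne_top
    (ENNReal.tsum_le_tsum fun k => hN (k + N) (Nat.le_add_left _ _)))
  filter_upwards [h] with ω hω
  obtain ⟨K, hK⟩ := eventually_atTop.1 hω
  refine eventually_atTop.2 ⟨K + N, fun k hk => ?_⟩
  have := hK (k - N) (by omega)
  rwa [show k - N + N = k by omega] at this

/-- Kolmogorov's one-series theorem. -/
theorem ae_exists_tendsto_sum_of_iIndepFun {P : Measure Ω} [IsProbabilityMeasure P]
    {Z : ℕ → Ω → ℝ} (hmeas : ∀ k, Measurable (Z k)) (hL2 : ∀ k, MemLp (Z k) 2 P)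
    (hindep : iIndepFun Z P) (hmean : ∀ k, ∫ ω, Z k ω ∂P = 0)
    (hsum : Summable fun k => ∫ ω, Z k ω ^ 2 ∂P) :
    ∀ᵐ ω ∂P, ∃ s, Tendsto (fun n => ∑ k ∈ Finset.range n, Z k ω) atTop (𝓝 s) := by
  have hsm : ∀ k, StronglyMeasurable (Z k) := fun k => (hmeas k).stronglyMeasurable
  set ℱ := Filtration.natural Z hsm
  -- The range is `n + 1` so that `f n` uses exactly the variables known to the natural filtration
  -- at time `n`.
  set f : ℕ → Ω → ℝ := fun n ω => ∑ k ∈ Finset.range (n + 1), Z k ω with hf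
  have hint : ∀ n, Integrable (f n) P := fun n =>
    integrable_finsetSum _ fun k _ => (hL2 k).integrable (by norm_num)
  have hadp : StronglyAdapted ℱ f := by
    intro n
    refine Finset.stronglyMeasurable_fun_sum _ fun k hk => ?_
    exact (Filtration.stronglyAdapted_natural hsm k).mono
      (ℱ.mono (by have := Finset.mem_range.1 hk; omega))
  have hmart : Martingale f ℱ P := by
    refine martingale_of_condExp_sub_eq_zero_nat hadp hint fun n => ?_
    have h1 : f (n + 1) - f n = Z (n + 1) := by
      funext ω
      simp [hf, Finset.sum_range_succ _ (n + 1)]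
    rw [h1]
    refine (hindep.condExp_natural_ae_eq_of_lt hsm (Nat.lt_succ_self n)).trans ?_
    rw [Nat.succ_eq_add_one, hmean]
    rfl
  set V := ∑' k, ∫ ω, Z k ω ^ 2 ∂P with hV
  have hvar : ∀ n, ∫ ω, f n ω ^ 2 ∂P ≤ V := by
    intro n
    have h1 := IndepFun.variance_sum (μ := P) (X := Z) (s := Finset.range (n + 1))
      (fun i _ => hL2 i) (fun i _ j _ hij => hindep.indepFun hij)
    have h2 : ∀ k, variance (Z k) P = ∫ ω, Z k ω ^ 2 ∂P := fun k =>
      variance_of_integral_eq_zero (hmeas k).aemeasurable (hmean k)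
    have h3 : (∑ k ∈ Finset.range (n + 1), Z k) = f n := by
      funext ω; simp [hf]
    rw [h3, variance_of_integral_eq_zero (hint n).aemeasurable] at h1
    · rw [h1]
      simp_rw [h2]
      exact hsum.sum_le_tsum _ fun k _ => integral_nonneg fun ω => sq_nonneg _
    · rw [hf]
      simp only
      rw [integral_finsetSum _ fun k _ => (hL2 k).integrable (by norm_num)]
      simp [hmean]
  -- Martingale convergence needs only an `L¹` bound, obtained from `|y| ≤ 1 + y ^ 2`.
  have hbdd : ∀ n, eLpNorm (f n) 1 P ≤ (Real.toNNReal (1 + V) : NNReal) := by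
    intro n
    have hfL2 : MemLp (f n) 2 P := memLp_finsetSum _ fun k _ => hL2 k
    rw [eLpNorm_one_eq_lintegral_enorm, ← ofReal_integral_norm_eq_lintegral_enorm (hint n)]
    refine ENNReal.ofReal_le_ofReal ?_
    calc ∫ ω, ‖f n ω‖ ∂P ≤ ∫ ω, (1 + f n ω ^ 2) ∂P := by
          refine integral_mono (hint n).norm ((integrable_const _).add hfL2.integrable_sq)
            fun ω => ?_
          simp only [Real.norm_eq_abs]
          nlinarith [sq_abs (f n ω), sq_nonneg (|f n ω| - 1)]
      _ = 1 + ∫ ω, f n ω ^ 2 ∂P := by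
          rw [integral_add (integrable_const _) hfL2.integrable_sq]; simp
      _ ≤ 1 + V := by linarith [hvar n]
  filter_upwards [hmart.submartingale.exists_ae_tendsto_of_bdd hbdd] with ω hω
  obtain ⟨s, hs⟩ := hω
  exact ⟨s, (tendsto_add_atTop_iff_nat 1).1 hs⟩

/-! ### Uniform bounds and increments from zero -/

/-- Uniform estimates that follow from (S1)–(S3) and are inherited by the centred family. -/
structure UniformBounds (Y : ℕ → ℝ → Ω → ℝ) (P : Measure Ω) : Prop where
  decay : ∃ δ : ℝ, 0 < δ ∧ ∀ ε : ℝ, 0 < ε → ∃ C : ℝ, 0 < C ∧ ∀ (k : ℕ) (m : ℝ), 0 < m →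
    P {ω | ε < |Y k m ω|} ≤ ENNReal.ofReal (C / m ^ δ)
  secondMoment : ∃ V : ℝ, 0 < V ∧ ∀ (k : ℕ) (m : ℝ), 0 ≤ m →
    MemLp (Y k m) 2 P ∧ ∫ ω, Y k m ω ^ 2 ∂P ≤ V
  increment : ∃ β C : ℝ, 1 < β ∧ β ≤ 2 ∧ 1 ≤ C ∧ ∀ (k : ℕ) (r m x : ℝ), 0 < r → 0 ≤ m → 0 < x →
    P {ω | ∃ s ∈ Set.Icc (0 : ℝ) m, x ≤ |(r + s) * Y k (r + s) ω - r * Y k r ω|}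
      ≤ ENNReal.ofReal (C * (m / x) ^ β)

theorem measure_le_abs_of_secondMoment {P : Measure Ω} [IsFiniteMeasure P] {Y : Ω → ℝ}
    (hY : MemLp Y 2 P) {V : ℝ} (hV : ∫ ω, Y ω ^ 2 ∂P ≤ V) {x : ℝ} (hx : 0 < x) :
    P {ω | x ≤ |Y ω|} ≤ ENNReal.ofReal (V / x ^ 2) := by
  have h := mul_meas_ge_le_integral_of_nonneg (μ := P) (f := fun ω => Y ω ^ 2)
    (ae_of_all _ fun ω => sq_nonneg _) hY.integrable_sq (x ^ 2)
  have h2 : {ω | x ≤ |Y ω|} = {ω | x ^ 2 ≤ Y ω ^ 2} := by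
    ext ω
    simp only [Set.mem_ofPred_eq]
    rw [← sq_abs (Y ω)]
    exact (pow_le_pow_iff_left₀ hx.le (abs_nonneg _) two_ne_zero).symm
  rw [h2, ← ofReal_measureReal]
  refine ENNReal.ofReal_le_ofReal ?_
  rw [le_div_iff₀ (by positivity), mul_comm]
  exact h.trans hV

/-- Reduces a tail bound to the range where it is nontrivial. There the base of the power is at most
`1`, so exponents may be lowered. -/
theorem prob_le_of_le_one {P : Measure Ω} [IsProbabilityMeasure P] {s : Set Ω} {b : ℝ}
    (h : b ≤ 1 → P s ≤ ENNReal.ofReal b) : P s ≤ ENNReal.ofReal b := by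
  rcases le_total b 1 with hb | hb
  · exact h hb
  · exact prob_le_one.trans (by simpa using ENNReal.ofReal_le_ofReal hb)

theorem measure_le_add_ofReal {P : Measure Ω} {s u v : Set Ω} {a b c : ℝ} (hs : s ⊆ u ∪ v)
    (hu : P u ≤ ENNReal.ofReal a) (hv : P v ≤ ENNReal.ofReal b) (ha : 0 ≤ a) (hb : 0 ≤ b)
    (hc : a + b ≤ c) : P s ≤ ENNReal.ofReal c :=
  calc P s ≤ P u + P v := (measure_mono hs).trans (measure_union_le _ _)
    _ ≤ ENNReal.ofReal (a + b) := by rw [ENNReal.ofReal_add ha hb]; gcongr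
    _ ≤ _ := ENNReal.ofReal_le_ofReal hc

/-- The increment bound of `UniformBounds`, extended to increments that start at `0`. -/
theorem UniformBounds.increment_of_nonneg {Y : ℕ → ℝ → Ω → ℝ} {P : Measure Ω}
    [IsProbabilityMeasure P] (h : UniformBounds Y P) :
    ∃ β C : ℝ, 1 < β ∧ 1 ≤ C ∧ ∀ (k : ℕ) (r m x : ℝ), 0 ≤ r → 0 ≤ m → 0 < x →
      P {ω | ∃ s ∈ Set.Icc (0 : ℝ) m, x ≤ |(r + s) * Y k (r + s) ω - r * Y k r ω|}
        ≤ ENNReal.ofReal (C * (m / x) ^ β) := by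
  obtain ⟨β, C, hβ, hβ2, hC, hinc⟩ := h.increment
  obtain ⟨V, hV, hmom⟩ := h.secondMoment
  -- The level `x` is split in halves, whence `2 ^ β`; `V` pays for the starting value and `C` for
  -- the increment after it.
  refine ⟨β, (V + C) * 2 ^ β, hβ, ?_, fun k r m x hr hm hx => ?_⟩
  · have : (1 : ℝ) ≤ 2 ^ β := Real.one_le_rpow (by norm_num) (by linarith)
    nlinarith
  rw [mul_assoc, ← Real.mul_rpow (by norm_num) (by positivity)]
  have hle : (m / x) ^ β ≤ (2 * (m / x)) ^ β :=
    Real.rpow_le_rpow (by positivity) (by linarith [show 0 ≤ m / x by positivity]) (by linarith)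
  have hnn : 0 ≤ (m / x) ^ β := by positivity
  rcases hr.eq_or_lt with rfl | hr
  swap
  · refine (hinc k r m x hr hm hx).trans (ENNReal.ofReal_le_ofReal ?_)
    exact mul_le_mul (by linarith) hle hnn (by linarith)
  refine prob_le_of_le_one fun hb => ?_
  have hb' : 2 * (m / x) ≤ 1 := by
    by_contra! hlt
    have := Real.one_lt_rpow hlt (show 0 < β by linarith)
    nlinarith
  rcases hm.eq_or_lt with rfl | hm
  · refine (measure_mono (t := ∅) ?_).trans (by simp)
    rintro ω ⟨s, hs, hxs⟩
    have : s = 0 := le_antisymm hs.2 hs.1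
    subst this
    simp at hxs
    linarith
  -- The start `0` is approached by positive starts `ρ i` decreasing to `0`. The events `F i`
  -- increase, and continuity from below needs no measurability.
  set ρ : ℕ → ℝ := fun i => m / (i + 1) with hρ
  have hρpos : ∀ i, 0 < ρ i := fun i => by simp only [hρ]; positivity
  have hρle : ∀ i, ρ i ≤ m := fun i => div_le_self hm.le (by
    have : (0 : ℝ) ≤ i := i.cast_nonneg
    linarith)
  have hρanti : Antitone ρ := fun i j hij => by
    simp only [hρ]
    gcongr
  have hρlim : Tendsto ρ atTop (𝓝 0) := by
    simpa [hρ, div_eq_mul_inv] using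
      (tendsto_one_div_add_atTop_nhds_zero_nat (𝕜 := ℝ)).const_mul m
  set F : ℕ → Set Ω := fun i => {ω | ∃ s ∈ Set.Icc (ρ i) m, x ≤ |s * Y k s ω|} with hF
  have hFmono : Monotone F := fun i j hij ω ⟨s, hs, hxs⟩ =>
    ⟨s, ⟨(hρanti hij).trans hs.1, hs.2⟩, hxs⟩
  have hsub : {ω | ∃ s ∈ Set.Icc (0 : ℝ) m, x ≤ |(0 + s) * Y k (0 + s) ω - 0 * Y k 0 ω|}
      ⊆ ⋃ i, F i := by
    rintro ω ⟨s, hs, hxs⟩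
    simp only [zero_add, zero_mul, sub_zero] at hxs
    have hs0 : 0 < s := by
      rcases hs.1.eq_or_lt with rfl | h0
      · simp at hxs; linarith
      · exact h0
    obtain ⟨i, hi⟩ := (hρlim.eventually_lt_const hs0).exists
    exact Set.mem_iUnion.2 ⟨i, s, ⟨hi.le, hs.2⟩, hxs⟩
  refine (measure_mono hsub).trans ?_
  rw [hFmono.measure_iUnion]
  refine iSup_le fun i => ?_
  have h1 := measure_le_abs_of_secondMoment (hmom k (ρ i) (hρpos i).le).1
    (hmom k (ρ i) (hρpos i).le).2 (show 0 < x / 2 / ρ i by have := hρpos i; positivity)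
  have h2 := hinc k (ρ i) (m - ρ i) (x / 2) (hρpos i) (by linarith [hρle i]) (by linarith)
  refine measure_le_add_ofReal ?_ h1 h2 (by have := hρpos i; positivity)
    (mul_nonneg (by linarith) (Real.rpow_nonneg (div_nonneg (by linarith [hρle i])
      (by linarith)) _)) ?_
  · rintro ω ⟨s, hs, hxs⟩
    by_cases hc : x / 2 ≤ ρ i * |Y k (ρ i) ω|
    · left
      rw [Set.mem_ofPred_eq, div_le_iff₀ (hρpos i), mul_comm]
      exact hc
    · right
      refine ⟨s - ρ i, ⟨by linarith [hs.1], by linarith [hs.2]⟩, ?_⟩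
      rw [add_sub_cancel]
      have h3 := abs_sub_abs_le_abs_sub (s * Y k s ω) (ρ i * Y k (ρ i) ω)
      have h4 : |ρ i * Y k (ρ i) ω| = ρ i * |Y k (ρ i) ω| := by
        rw [abs_mul, abs_of_pos (hρpos i)]
      linarith
  -- Chebyshev gives a square, which is dominated by the power `β ≤ 2` because its base is at most
  -- `1`.
  · have e1 : V / (x / 2 / ρ i) ^ 2 ≤ V * (2 * (m / x)) ^ β := by
      rw [div_eq_mul_inv]
      gcongr
      calc ((x / 2 / ρ i) ^ 2)⁻¹ = (2 * (ρ i / x)) ^ 2 := by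
            have := hρpos i
            field_simp
        _ ≤ (2 * (m / x)) ^ 2 := by
            have := hρpos i
            gcongr
            exact hρle i
        _ = (2 * (m / x)) ^ (2 : ℝ) := by norm_cast
        _ ≤ _ := Real.rpow_le_rpow_of_exponent_ge (by positivity) hb' hβ2
    have e2 : C * ((m - ρ i) / (x / 2)) ^ β ≤ C * (2 * (m / x)) ^ β := by
      gcongr
      · exact div_nonneg (by linarith [hρle i]) (by linarith)
      · rw [div_le_iff₀ (by linarith)]
        have : 2 * (m / x) * (x / 2) = m := by field_simp
        linarith [hρpos i]
    linarith

/-! ### Strong law along completed increments -/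

theorem summable_sq_mass_ratio_of_le {m : ℕ → ℝ} (hm : ∀ k, 0 ≤ m k)
    (hdiv : Tendsto (cumMass m) atTop atTop) {d : ℝ} (hd : 0 < d) :
    Summable fun k =>
      if m k ≤ cumMass m (k + 1) ^ (1 - d) then (m k / cumMass m (k + 1)) ^ 2 else 0 := by
  refine (summable_mass_mul_rpow hm hdiv hd).of_nonneg_of_le (fun k => ?_) fun k => ?_
  · split_ifs
    · positivity
    · exact le_rfl
  · have hM := cumMass_nonneg hm (k + 1)
    have hr := mul_nonneg (hm k) (Real.rpow_nonneg hM (-(1 + d)))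
    split_ifs with h
    · rcases hM.eq_or_lt with h0 | h0
      · rw [← h0] at hr ⊢
        simpa using hr
      · calc (m k / cumMass m (k + 1)) ^ 2 = m k * (m k * (cumMass m (k + 1) ^ 2)⁻¹) := by
              field_simp
          _ ≤ m k * (cumMass m (k + 1) ^ (1 - d) * (cumMass m (k + 1) ^ 2)⁻¹) := by
              gcongr
              exact hm k
          _ = m k * cumMass m (k + 1) ^ (-(1 + d)) := by
              rw [← Real.rpow_natCast, ← Real.rpow_neg hM, ← Real.rpow_add h0]
              congr 2
              push_cast
              ring
    · exact hr

/-- Terms of large relative mass tend to zero almost surely. -/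
theorem ae_tendsto_largeTerms {Y : ℕ → ℝ → Ω → ℝ} {P : Measure Ω}
    [IsProbabilityMeasure P] {m : ℕ → ℝ} (hm : ∀ k, 0 ≤ m k)
    (hdiv : Tendsto (cumMass m) atTop atTop) {δ d : ℝ} (hδ : 0 < δ) (hd : d < δ * (1 - d))
    (hdecay : ∀ ε : ℝ, 0 < ε → ∃ C : ℝ, 0 < C ∧ ∀ (k : ℕ) (m : ℝ), 0 < m →
      P {ω | ε < |Y k m ω|} ≤ ENNReal.ofReal (C / m ^ δ)) :
    ∀ᵐ ω ∂P, Tendsto (fun k => if m k ≤ cumMass m (k + 1) ^ (1 - d) then 0 else Y k (m k) ω)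
      atTop (𝓝 0) := by
  have key : ∀ q : ℕ, ∀ᵐ ω ∂P, ∀ᶠ k in atTop, ω ∉ {ω | 1 / ((q : ℝ) + 1) <
      |if m k ≤ cumMass m (k + 1) ^ (1 - d) then 0 else Y k (m k) ω|} := by
    intro q
    have hq : (0 : ℝ) < 1 / (q + 1) := by positivity
    obtain ⟨C, hC, hCb⟩ := hdecay _ hq
    refine ae_eventually_notMem_of_le
      ((summable_mass_mul_rpow hm hdiv (sub_pos.2 hd)).mul_left C) ?_
    filter_upwards [((tendsto_add_atTop_iff_nat 1).2 hdiv).eventually_gt_atTop 0] with k hk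
    by_cases h : m k ≤ cumMass m (k + 1) ^ (1 - d)
    · simp only [if_pos h, abs_zero]
      rw [show {ω : Ω | 1 / ((q : ℝ) + 1) < 0} = ∅ from
        Set.eq_empty_of_forall_notMem fun ω hω => lt_asymm hq hω]
      simp
    · simp only [if_neg h]
      push Not at h
      set M := cumMass m (k + 1) with hM
      have hMp : 0 < M ^ (1 - d) := by positivity
      have hmk : 0 < m k := hMp.trans h
      refine (hCb k (m k) hmk).trans (ENNReal.ofReal_le_ofReal ?_)
      rw [div_eq_mul_inv, ← Real.rpow_neg hmk.le]
      gcongr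
      -- The lower bound on `m k` is used twice: to estimate the decay, and to trade a factor `M ^
      -- (1 - d)` for `m k`.
      calc m k ^ (-δ) ≤ (M ^ (1 - d)) ^ (-δ) :=
            Real.rpow_le_rpow_of_nonpos hMp h.le (by linarith)
        _ = M ^ (1 - d) * M ^ (-(1 + (δ * (1 - d) - d))) := by
            rw [← Real.rpow_mul hk.le, ← Real.rpow_add hk]
            congr 1
            ring
        _ ≤ m k * M ^ (-(1 + (δ * (1 - d) - d))) := by gcongr
  filter_upwards [ae_all_iff.2 key] with ω hω
  refine Metric.tendsto_nhds.2 fun ε hε => ?_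
  obtain ⟨q, hq⟩ := exists_nat_one_div_lt hε
  filter_upwards [hω q] with k hk
  rw [Real.dist_eq, sub_zero]
  simp only [not_lt] at hk
  exact hk.trans_lt hq

/-- The strong law along the completed increments. -/
theorem UniformBounds.ae_tendsto_average {Y : ℕ → ℝ → Ω → ℝ} {P : Measure Ω}
    [IsProbabilityMeasure P] (h : UniformBounds Y P) {m : ℕ → ℝ} (hm : ∀ k, 0 ≤ m k)
    (hdiv : Tendsto (cumMass m) atTop atTop) (hmeas : ∀ k, Measurable (Y k (m k)))
    (hmean : ∀ k, ∫ ω, Y k (m k) ω ∂P = 0) (hindep : iIndepFun (fun k => Y k (m k)) P) :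
    ∀ᵐ ω ∂P, Tendsto
      (fun n => (∑ k ∈ Finset.range n, m k * Y k (m k) ω) / cumMass m n) atTop (𝓝 0) := by
  obtain ⟨δ, hδ, hdecay⟩ := h.decay
  obtain ⟨V, hV, hmom⟩ := h.secondMoment
  -- Chosen so that `d * (1 + δ) = δ / 2 < δ`, which leaves a positive excess exponent for small and
  -- large masses alike.
  set d := δ / (2 * (1 + δ)) with hd
  have hd0 : 0 < d := by positivity
  have hdδ : d < δ * (1 - d) := by
    have : d * (1 + δ) = δ / 2 := by rw [hd]; field_simp
    linarith
  set c : ℕ → ℝ := fun k =>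
    if m k ≤ cumMass m (k + 1) ^ (1 - d) then m k / cumMass m (k + 1) else 0 with hc
  have hsum : Summable fun k => ∫ ω, (c k * Y k (m k) ω) ^ 2 ∂P := by
    refine ((summable_sq_mass_ratio_of_le hm hdiv hd0).mul_right V).of_nonneg_of_le
      (fun k => integral_nonneg fun ω => sq_nonneg _) fun k => ?_
    simp_rw [mul_pow]
    rw [integral_const_mul]
    have h1 : c k ^ 2 =
        if m k ≤ cumMass m (k + 1) ^ (1 - d) then (m k / cumMass m (k + 1)) ^ 2 else 0 := by
      simp only [hc]
      split_ifs <;> simp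
    rw [← h1]
    exact mul_le_mul_of_nonneg_left (hmom k _ (hm k)).2 (sq_nonneg _)
  have hsmall := ae_exists_tendsto_sum_of_iIndepFun (P := P)
    (Z := fun k ω => c k * Y k (m k) ω) (fun k => (hmeas k).const_mul _)
    (fun k => (hmom k _ (hm k)).1.const_mul _)
    (hindep.comp (fun k x => c k * x) fun k => measurable_const_mul _)
    (fun k => by rw [integral_const_mul, hmean, mul_zero]) hsum
  filter_upwards [hsmall, ae_tendsto_largeTerms (Y := Y) hm hdiv hδ hdδ hdecay]
    with ω ⟨s, hs⟩ hω
  have h1 := (kronecker_cumMass hm hdiv hs).add (tendsto_weighted_average_zero hm hdiv hω)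
  rw [add_zero] at h1
  refine h1.congr fun n => ?_
  rw [← add_div, ← Finset.sum_add_distrib]
  congr 1
  refine Finset.sum_congr rfl fun k _ => ?_
  simp only [hc]
  split_ifs with hk
  · have hM := cumMass_nonneg hm (k + 1)
    rcases hM.eq_or_lt with h0 | h0
    · have : m k = 0 := by
        have h2 := cumMass_nonneg hm k
        rw [cumMass_succ] at h0
        linarith [hm k]
      simp [this]
    · field_simp
      ring
  · ring

/-! ### The uncompleted increment -/

/-- Oscillation of the last, uncompleted increment over a time interval. -/
theorem measure_exists_remTime_le {Y : ℕ → ℝ → Ω → ℝ} {P : Measure Ω} {β C : ℝ} (hβ : 1 < β)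
    (hC : 0 ≤ C)
    (hinc : ∀ (k : ℕ) (r m x : ℝ), 0 ≤ r → 0 ≤ m → 0 < x →
      P {ω | ∃ s ∈ Set.Icc (0 : ℝ) m, x ≤ |(r + s) * Y k (r + s) ω - r * Y k r ω|}
        ≤ ENNReal.ofReal (C * (m / x) ^ β))
    {m : ℕ → ℝ} (hm : ∀ k, 0 ≤ m k) (hdiv : Tendsto (cumMass m) atTop atTop)
    {a b x : ℝ} (ha : 0 < a) (hab : a ≤ b) (hx : 0 < x) :
    P {ω | ∃ t ∈ Set.Ioc a b, 2 * x ≤ |remTime m t * Y (lastIndex m t) (remTime m t) ω|}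
      ≤ ENNReal.ofReal (C * ((b - a) / x) ^ β)
        + P {ω | x ≤ |remTime m a * Y (lastIndex m a) (remTime m a) ω|} := by
  -- Clamping to `[a, b]` makes `l n` the length of the `n`-th increment inside the window; for
  -- increments beginning before `b`, `r n` below is the time already spent in it when the window
  -- opens.
  set cl : ℝ → ℝ := fun y => max a (min b y) with hcl
  have hclmono : Monotone cl := fun y z hyz => max_le_max le_rfl (min_le_min le_rfl hyz)
  set l : ℕ → ℝ := fun n => cl (cumMass m (n + 1)) - cl (cumMass m n) with hl
  have hl0 : ∀ n, 0 ≤ l n := fun n => sub_nonneg.2 (hclmono (cumMass_mono hm n.le_succ))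
  have hlsum : ∀ n, ∑ k ∈ Finset.range n, l k ≤ b - a := by
    intro n
    rw [Finset.sum_range_sub (fun k => cl (cumMass m k))]
    have h1 : cl (cumMass m n) ≤ b := max_le hab (min_le_left _ _)
    have h2 : a ≤ cl (cumMass m 0) := le_max_left _ _
    linarith
  have hlle : ∀ n, l n ≤ b - a := fun n => by
    have h1 : cl (cumMass m (n + 1)) ≤ b := max_le hab (min_le_left _ _)
    have h2 : a ≤ cl (cumMass m n) := le_max_left _ _
    simp only [hl]
    linarith
  set r : ℕ → ℝ := fun n => max a (cumMass m n) - cumMass m n with hr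
  have hr0 : ∀ n, 0 ≤ r n := fun n => sub_nonneg.2 (le_max_right _ _)
  set A : ℕ → Set Ω := fun n => {ω | ∃ s ∈ Set.Icc (0 : ℝ) (l n),
    x ≤ |(r n + s) * Y n (r n + s) ω - r n * Y n (r n) ω|} with hA
  set L := lastIndex m b with hL
  have hsub : {ω | ∃ t ∈ Set.Ioc a b,
      2 * x ≤ |remTime m t * Y (lastIndex m t) (remTime m t) ω|}
      ⊆ (⋃ n ∈ Finset.range (L + 1), A n)
        ∪ {ω | x ≤ |remTime m a * Y (lastIndex m a) (remTime m a) ω|} := by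
    rintro ω ⟨t, ⟨hat, htb⟩, hxt⟩
    have ht0 : 0 < t := ha.trans hat
    set n := lastIndex m t with hn
    have hn1 : cumMass m n < t := cumMass_lastIndex_lt ht0
    have hn2 : t ≤ cumMass m (n + 1) := le_cumMass_lastIndex_succ hdiv t
    have hnL : n ≤ L := Nat.sInf_le (htb.trans (le_cumMass_lastIndex_succ hdiv b))
    have hrs : r n + (t - max a (cumMass m n)) = remTime m t := by
      simp only [hr, remTime, ← hn]
      ring
    -- A large starting value forces `r n ≠ 0`. The increment then began before `a`, and the event
    -- is the one at time `a`. Otherwise the change since the start is at least `x`.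
    by_cases hc : x ≤ |r n * Y n (r n) ω|
    · right
      have hrn : r n ≠ 0 := by
        intro h0
        rw [h0] at hc
        simp at hc
        linarith
      have hMa : cumMass m n < a := by
        by_contra! hle
        exact hrn (by simp only [hr, max_eq_right hle, sub_self])
      have hna : lastIndex m a = n := lastIndex_eq hm hMa (hat.le.trans hn2)
      have hra : remTime m a = r n := by
        simp only [hr, remTime, hna, max_eq_left hMa.le]
      rw [Set.mem_ofPred_eq, hna, hra]
      exact hc
    · left
      refine Set.mem_biUnion (Finset.mem_coe.2 (Finset.mem_range.2 (Nat.lt_succ_of_le hnL)))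
        ⟨t - max a (cumMass m n), ⟨sub_nonneg.2 (max_le hat.le hn1.le), ?_⟩, ?_⟩
      · have h1 : t ≤ cl (cumMass m (n + 1)) := le_max_of_le_right (le_min htb hn2)
        have h2 : cl (cumMass m n) = max a (cumMass m n) := by
          simp only [hcl, min_eq_right (hn1.le.trans htb)]
        simp only [hl, h2]
        linarith
      · rw [hrs]
        have := abs_sub_abs_le_abs_sub (remTime m t * Y n (remTime m t) ω) (r n * Y n (r n) ω)
        linarith
  -- Pulling out the power `β - 1` leaves a bound linear in `l n`, and these lengths sum to at most
  -- `b - a`.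
  have hterm : ∀ n, C * (l n / x) ^ β ≤ C * (((b - a) / x) ^ (β - 1) * (l n / x)) := by
    intro n
    gcongr
    have h0 : 0 ≤ l n / x := div_nonneg (hl0 n) hx.le
    calc (l n / x) ^ β = (l n / x) ^ (β - 1) * (l n / x) := by
          conv_lhs => rw [show β = (β - 1) + 1 by ring,
            Real.rpow_add_of_nonneg h0 (by linarith) zero_le_one, Real.rpow_one]
      _ ≤ _ := by
          gcongr
          exact hlle n
  refine (measure_mono hsub).trans ((measure_union_le _ _).trans (add_le_add_left ?_ _))
  calc P (⋃ n ∈ Finset.range (L + 1), A n) ≤ ∑ n ∈ Finset.range (L + 1), P (A n) :=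
        measure_biUnion_finset_le _ _
    _ ≤ ∑ n ∈ Finset.range (L + 1), ENNReal.ofReal (C * (l n / x) ^ β) :=
        Finset.sum_le_sum fun n _ => hinc n (r n) (l n) x (hr0 n) (hl0 n) hx
    _ = ENNReal.ofReal (∑ n ∈ Finset.range (L + 1), C * (l n / x) ^ β) :=
        (ENNReal.ofReal_sum_of_nonneg fun n _ => mul_nonneg hC
          (Real.rpow_nonneg (div_nonneg (hl0 n) hx.le) _)).symm
    _ ≤ _ := by
        refine ENNReal.ofReal_le_ofReal ((Finset.sum_le_sum fun n _ => hterm n).trans ?_)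
        rw [← Finset.mul_sum, ← Finset.mul_sum, ← Finset.sum_div]
        gcongr
        have h0 : 0 ≤ (b - a) / x := div_nonneg (sub_nonneg.2 hab) hx.le
        calc ((b - a) / x) ^ (β - 1) * ((∑ i ∈ Finset.range (L + 1), l i) / x)
            ≤ ((b - a) / x) ^ (β - 1) * ((b - a) / x) := by
              gcongr
              exact hlsum _
          _ = _ := by
              conv_rhs => rw [show β = (β - 1) + 1 by ring,
                Real.rpow_add_of_nonneg h0 (by linarith) zero_le_one, Real.rpow_one]

theorem one_add_pow_le {u : ℝ} (hu : 0 ≤ u) (hu1 : u ≤ 1) (p : ℕ) :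
    (1 + u) ^ p ≤ 1 + (2 ^ p - 1) * u := by
  induction p with
  | zero => simp
  | succ p ih =>
    have h1 : (1 : ℝ) ≤ 2 ^ p := one_le_pow₀ (by norm_num)
    calc (1 + u) ^ (p + 1) ≤ (1 + (2 ^ p - 1) * u) * (1 + u) := by rw [pow_succ]; gcongr
      _ = 1 + u + (2 ^ p - 1) * u * (1 + u) := by ring
      _ ≤ 1 + u + (2 ^ p - 1) * u * 2 := by
          have : 0 ≤ (2 ^ p - 1) * u := mul_nonneg (by linarith) hu
          gcongr
          linarith
      _ = _ := by ring

/-- Polynomial grids have relative spacing of order `1 / y`; this makes the oscillation between grid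
times summable. -/
theorem pow_succ_sub_pow_le {y : ℝ} (hy : 1 ≤ y) (p : ℕ) :
    (y + 1) ^ p - y ^ p ≤ 2 ^ p * y ^ p / y := by
  have hy0 : 0 < y := by linarith
  have h := one_add_pow_le (u := 1 / y) (by positivity) (by rw [div_le_one hy0]; exact hy) p
  calc (y + 1) ^ p - y ^ p = y ^ p * ((1 + 1 / y) ^ p - 1) := by
        rw [mul_sub, ← mul_pow]
        field_simp
    _ ≤ y ^ p * (2 ^ p * (1 / y)) := by
        gcongr
        have : 0 ≤ 1 / y := by positivity
        linarith
    _ = _ := by ring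

/-- The last, uncompleted increment at the polynomially growing times `y ^ (p + 1)`. -/
theorem UniformBounds.exists_measure_remTime_pow_le {Y : ℕ → ℝ → Ω → ℝ} {P : Measure Ω}
    [IsProbabilityMeasure P] (h : UniformBounds Y P) :
    ∃ p : ℕ, ∀ ε : ℝ, 0 < ε → ∃ K : ℝ, ∀ m : ℕ → ℝ, (∀ k, 0 ≤ m k) → ∀ y : ℝ, 1 ≤ y →
      P {ω | ε * y ^ (p + 1) ≤ |remTime m (y ^ (p + 1)) *
        Y (lastIndex m (y ^ (p + 1))) (remTime m (y ^ (p + 1))) ω|}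
      ≤ ENNReal.ofReal (K * y ^ (-2 : ℝ)) := by
  obtain ⟨δ, hδ, hdecay⟩ := h.decay
  obtain ⟨V, hV, hmom⟩ := h.secondMoment
  -- The remaining time `r` is compared with `y ^ p`. If it is larger, decay gives `y ^ (-p * δ) ≤ y
  -- ^ (-2)`; if smaller, the level for `|Z|` is at least `ε * y` and Chebyshev gives order `y ^
  -- (-2)`.
  obtain ⟨p, hp⟩ := exists_nat_gt (2 / δ)
  refine ⟨p, fun ε hε => ?_⟩
  obtain ⟨C, hC, hCb⟩ := hdecay (ε / 2) (by positivity)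
  refine ⟨C + V / ε ^ 2, fun m hm y hy => ?_⟩
  have hy0 : 0 < y := by linarith
  set a := y ^ (p + 1) with ha
  have ha0 : 0 < a := by positivity
  set r := remTime m a with hr
  have hr0 : 0 < r := remTime_pos ha0
  have hra : r ≤ a := remTime_le hm a
  set Z := Y (lastIndex m a) r with hZ
  have hy2 : y ^ (-2 : ℝ) = (y ^ 2)⁻¹ := by rw [Real.rpow_neg hy0.le]; norm_cast
  rcases le_total (y ^ p) r with hc | hc
  · refine (measure_mono (t := {ω | ε / 2 < |Z ω|}) fun ω hω => ?_).trans
      ((hCb _ r hr0).trans (ENNReal.ofReal_le_ofReal ?_))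
    · rw [Set.mem_ofPred_eq, abs_mul, abs_of_pos hr0] at hω
      have h1 : ε * r ≤ r * |Z ω| := (mul_le_mul_of_nonneg_left hra hε.le).trans hω
      have h2 : ε ≤ |Z ω| := le_of_mul_le_mul_left (by linarith) hr0
      rw [Set.mem_ofPred_eq]
      linarith
    · have h1 : y ^ 2 ≤ r ^ δ := by
        calc y ^ 2 = y ^ (2 : ℝ) := by norm_cast
          _ ≤ y ^ (p * δ) := by
              apply Real.rpow_le_rpow_of_exponent_le hy
              rw [div_lt_iff₀ hδ] at hp
              exact hp.le
          _ = (y ^ p) ^ δ := by rw [Real.rpow_mul hy0.le]; norm_cast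
          _ ≤ r ^ δ := by gcongr
      rw [hy2, div_eq_mul_inv]
      gcongr
      have : 0 ≤ V / ε ^ 2 := by positivity
      linarith
  · refine (measure_mono (t := {ω | ε * y ≤ |Z ω|}) fun ω hω => ?_).trans
      ((measure_le_abs_of_secondMoment (hmom _ r hr0.le).1 (hmom _ r hr0.le).2
        (by positivity)).trans (ENNReal.ofReal_le_ofReal ?_))
    · rw [Set.mem_ofPred_eq, abs_mul, abs_of_pos hr0] at hω
      have h1 : ε * y * r ≤ ε * a := by
        rw [ha, pow_succ', mul_assoc]
        gcongr
      rw [Set.mem_ofPred_eq]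
      exact le_of_mul_le_mul_left (by linarith) hr0
    · rw [hy2, mul_pow]
      have : V / (ε ^ 2 * y ^ 2) = V / ε ^ 2 * (y ^ 2)⁻¹ := by field_simp
      rw [this]
      gcongr
      linarith

theorem UniformBounds.ae_tendsto_remTime {Y : ℕ → ℝ → Ω → ℝ} {P : Measure Ω}
    [IsProbabilityMeasure P] (h : UniformBounds Y P) {m : ℕ → ℝ} (hm : ∀ k, 0 ≤ m k)
    (hdiv : Tendsto (cumMass m) atTop atTop) :
    ∀ᵐ ω ∂P, Tendsto (fun t => remTime m t / t * Y (lastIndex m t) (remTime m t) ω)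
      atTop (𝓝 0) := by
  obtain ⟨β, C, hβ, hC, hinc⟩ := h.increment_of_nonneg
  obtain ⟨p, hp⟩ := h.exists_measure_remTime_pow_le
  set a : ℕ → ℝ := fun i => ((i : ℝ) + 1) ^ (p + 1) with ha
  have ha0 : ∀ i, 0 < a i := fun i => by positivity
  have hamono : Monotone a := fun i j hij => by simp only [ha]; gcongr
  have halim : Tendsto a atTop atTop :=
    (tendsto_pow_atTop (Nat.succ_ne_zero p)).comp
      (tendsto_atTop_add_const_right _ 1 tendsto_natCast_atTop_atTop)
  have key : ∀ q : ℕ, ∀ᵐ ω ∂P, ∀ᶠ i in atTop, ω ∉ {ω | ∃ t ∈ Set.Ioc (a i) (a (i + 1)),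
      2 * (1 / ((q : ℝ) + 1) * a i) ≤ |remTime m t * Y (lastIndex m t) (remTime m t) ω|} := by
    intro q
    set ε : ℝ := 1 / ((q : ℝ) + 1) with hε
    have hε0 : 0 < ε := by positivity
    obtain ⟨K, hK⟩ := hp ε hε0
    have hsummable : ∀ e : ℝ, 1 < e → Summable fun i : ℕ => ((i : ℝ) + 1) ^ (-e) := fun e he => by
      have h1 := (summable_nat_add_iff 1).2 (Real.summable_nat_rpow.2 (neg_lt_neg he))
      simpa using h1
    -- The first series bounds the oscillation between grid times, the second the values at them.
    refine ae_eventually_notMem_of_le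
      (((hsummable β hβ).mul_left (C * (2 ^ (p + 1) / ε) ^ β)).add
        ((hsummable 2 one_lt_two).mul_left (max K 0))) (Eventually.of_forall fun i => ?_)
    have hy : (1 : ℝ) ≤ (i : ℝ) + 1 := by linarith [(Nat.cast_nonneg i : (0 : ℝ) ≤ i)]
    have hy0 : (0 : ℝ) < (i : ℝ) + 1 := by linarith
    rw [ENNReal.ofReal_add (by positivity) (by positivity)]
    refine (measure_exists_remTime_le hβ (by linarith) hinc hm hdiv (ha0 i)
      (hamono i.le_succ) (mul_pos hε0 (ha0 i))).trans (add_le_add ?_ ?_)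
    · refine ENNReal.ofReal_le_ofReal ?_
      rw [mul_assoc C, Real.rpow_neg hy0.le, ← Real.inv_rpow hy0.le,
        ← Real.mul_rpow (by positivity) (by positivity)]
      have hd : 0 ≤ a (i + 1) - a i := sub_nonneg.2 (hamono i.le_succ)
      have hai := ha0 i
      gcongr
      rw [div_le_iff₀ (by positivity)]
      have h1 := pow_succ_sub_pow_le hy (p + 1)
      calc a (i + 1) - a i ≤ 2 ^ (p + 1) * a i / ((i : ℝ) + 1) := by
            simpa [ha] using h1
        _ = _ := by field_simp
    · refine (hK m hm _ hy).trans (ENNReal.ofReal_le_ofReal ?_)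
      gcongr
      exact le_max_left _ _
  filter_upwards [ae_all_iff.2 key] with ω hω
  refine Metric.tendsto_nhds.2 fun ε hε => ?_
  obtain ⟨q, hq⟩ := exists_nat_one_div_lt (show 0 < ε / 2 by positivity)
  obtain ⟨I, hI⟩ := eventually_atTop.1 (hω q)
  filter_upwards [eventually_gt_atTop (a I)] with t ht
  have ht0 : 0 < t := (ha0 I).trans ht
  -- The first grid time not before `t` is the right end of the window containing `t`.
  have hex : ∃ i, t ≤ a i := (halim.eventually_ge_atTop t).exists
  classical
  have hf := Nat.find_spec hex
  have hfI : I < Nat.find hex := by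
    by_contra! hle
    exact absurd (hf.trans (hamono hle)) (not_le.2 ht)
  obtain ⟨i, hi⟩ : ∃ i, Nat.find hex = i + 1 := ⟨Nat.find hex - 1, by omega⟩
  have hit : a i < t := not_le.1 (Nat.find_min hex (by omega))
  rw [hi] at hf
  have hn := hI i (by omega)
  simp only [not_exists, not_and, not_le] at hn
  have h1 := hn t ⟨hit, hf⟩
  rw [Real.dist_eq, sub_zero, div_mul_eq_mul_div, abs_div, abs_of_pos ht0, div_lt_iff₀ ht0]
  refine h1.trans ?_
  have h2 : 1 / ((q : ℝ) + 1) * a i < ε / 2 * t :=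
    mul_lt_mul'' hq hit (by positivity) (ha0 i).le
  linarith

/-! ### Combining completed and uncompleted increments -/

/-- The strong law for the gradual sums of a centred family. -/
theorem UniformBounds.ae_tendsto_gradualSum {Y : ℕ → ℝ → Ω → ℝ} {P : Measure Ω}
    [IsProbabilityMeasure P] (h : UniformBounds Y P) {m : ℕ → ℝ} (hm : ∀ k, 0 ≤ m k)
    (hdiv : Tendsto (cumMass m) atTop atTop) (hmeas : ∀ k, Measurable (Y k (m k)))
    (hmean : ∀ k, ∫ ω, Y k (m k) ω ∂P = 0) (hindep : iIndepFun (fun k => Y k (m k)) P) :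
    ∀ᵐ ω ∂P, Tendsto (fun t => gradualSum Y m t ω) atTop (𝓝 0) := by
  filter_upwards [h.ae_tendsto_average hm hdiv hmeas hmean hindep,
    h.ae_tendsto_remTime hm hdiv] with ω h1 h2
  have hl := tendsto_lastIndex hm hdiv
  have h3 : Tendsto (fun t => ∑ k ∈ Finset.range (lastIndex m t), m k / t * Y k (m k) ω)
      atTop (𝓝 0) := by
    -- Replacing the completed mass by the larger `t` in the denominator only shrinks the average.
    refine squeeze_zero_norm' ?_ (by simpa using (h1.comp hl).norm)
    filter_upwards [eventually_gt_atTop 0, hl.eventually (hdiv.eventually_gt_atTop 0)]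
      with t ht hM
    have h4 : ∑ k ∈ Finset.range (lastIndex m t), m k / t * Y k (m k) ω
        = (∑ k ∈ Finset.range (lastIndex m t), m k * Y k (m k) ω) / t := by
      rw [Finset.sum_div]
      exact Finset.sum_congr rfl fun k _ => by ring
    rw [h4, Real.norm_eq_abs, abs_div, abs_of_pos ht, abs_of_pos hM]
    gcongr
    exact (cumMass_lastIndex_lt ht).le
  simpa [gradualSum] using h3.add h2

/-! ### From the hypotheses to the uniform bounds -/

/-- Second moments are monotone under stochastic domination. -/
theorem memLp_two_of_measure_lt_abs_le {P : Measure Ω} [IsFiniteMeasure P] {Y Z : Ω → ℝ}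
    (hY : Measurable Y) (hZ : MemLp Z 2 P) (h : ∀ x : ℝ, P {ω | x < |Y ω|} ≤ P {ω | x < Z ω}) :
    MemLp Y 2 P ∧ ∫ ω, Y ω ^ 2 ∂P ≤ ∫ ω, Z ω ^ 2 ∂P := by
  have hrpow : ∀ x : ℝ, |x| ^ (2 : ℝ) = x ^ 2 := fun x => by norm_cast; exact sq_abs x
  -- The layer-cake formula turns the comparison of tails into one of second moments.
  have hle : ∫⁻ ω, ENNReal.ofReal (Y ω ^ 2) ∂P ≤ ∫⁻ ω, ENNReal.ofReal (Z ω ^ 2) ∂P := by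
    simp_rw [← hrpow]
    rw [lintegral_rpow_eq_lintegral_meas_lt_mul P (ae_of_all _ fun ω => abs_nonneg _)
        hY.abs.aemeasurable two_pos,
      lintegral_rpow_eq_lintegral_meas_lt_mul P (ae_of_all _ fun ω => abs_nonneg _)
        hZ.aestronglyMeasurable.aemeasurable.abs two_pos]
    exact mul_le_mul' le_rfl (lintegral_mono fun x => mul_le_mul' ((h x).trans
      (measure_mono fun ω (hω : x < Z ω) => hω.trans_le (le_abs_self _))) le_rfl)
  have hfin : ∫⁻ ω, ENNReal.ofReal (Z ω ^ 2) ∂P < ⊤ := hZ.integrable_sq.lintegral_lt_top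
  have hYint : Integrable (fun ω => Y ω ^ 2) P := by
    refine ⟨(hY.pow_const 2).aestronglyMeasurable, ?_⟩
    rw [hasFiniteIntegral_iff_ofReal (ae_of_all _ fun ω => sq_nonneg _)]
    exact hle.trans_lt hfin
  refine ⟨(memLp_two_iff_integrable_sq hY.aestronglyMeasurable).2 hYint, ?_⟩
  rw [integral_eq_lintegral_of_nonneg_ae (ae_of_all _ fun ω => sq_nonneg _)
      hYint.aestronglyMeasurable,
    integral_eq_lintegral_of_nonneg_ae (ae_of_all _ fun ω => sq_nonneg _)
      hZ.integrable_sq.aestronglyMeasurable]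
  exact ENNReal.toReal_mono hfin.ne hle

/-- (S3) is needed only at `ε = 1`, since its `t` is a free level. Capping `β` at `2` is harmless
because the bound is trivial unless `m / x ≤ 1`. -/
theorem SatisfiesS.uniformBounds {Y : ℕ → ℝ → Ω → ℝ} {P : Measure Ω} [IsProbabilityMeasure P]
    (hmeas : ∀ (k : ℕ) (m : ℝ), 0 ≤ m → Measurable (Y k m)) (h : SatisfiesS Y P) :
    UniformBounds Y P := by
  obtain ⟨⟨δ, hδ, h1⟩, ⟨Xs, γ, hXs, hγ, hXint, hdom⟩, h3⟩ := h
  refine ⟨⟨δ, hδ, fun ε hε => ?_⟩, ?_, ?_⟩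
  · obtain ⟨C, hC⟩ := h1 ε hε
    refine ⟨max C 1, by positivity, fun k m hm => ?_⟩
    refine (le_iSup (fun k => P {ω | ε < |Y k m ω|}) k).trans ((hC m hm).le.trans
      (ENNReal.ofReal_le_ofReal ?_))
    gcongr
    exact le_max_left _ _
  · have hXs2 : MemLp Xs 2 P := by
      have hp : MemLp Xs (ENNReal.ofReal (2 + γ)) P := by
        rw [← integrable_norm_rpow_iff hXs.aestronglyMeasurable
          (by simpa using (by linarith : 0 < 2 + γ)) ENNReal.ofReal_ne_top,
          ENNReal.toReal_ofReal (by linarith)]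
        exact hXint
      refine hp.mono_exponent ?_
      rw [← ENNReal.ofReal_ofNat]
      exact ENNReal.ofReal_le_ofReal (by linarith)
    refine ⟨1 + ∫ ω, Xs ω ^ 2 ∂P, ?_, fun k m hm => ?_⟩
    · have : 0 ≤ ∫ ω, Xs ω ^ 2 ∂P := integral_nonneg fun ω => sq_nonneg _
      linarith
    · have := memLp_two_of_measure_lt_abs_le (hmeas k m hm) hXs2 fun x =>
        ((le_iSup_of_le k (le_iSup_of_le m (le_iSup_of_le hm le_rfl))).trans (hdom x) :)
      exact ⟨this.1, by linarith [this.2]⟩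
  · obtain ⟨β, C, hβ, hC, hb⟩ := h3 1 one_pos
    refine ⟨min β 2, max C 1, lt_min hβ one_lt_two, min_le_right _ _, le_max_right _ _,
      fun k r m x hr hm hx => prob_le_of_le_one fun hle => ?_⟩
    have hmx : m / x ≤ 1 := by
      by_contra! hlt
      have := Real.one_lt_rpow hlt (show 0 < min β 2 from lt_min (by linarith) two_pos)
      nlinarith [le_max_right C 1]
    have hsub : {ω | ∃ s ∈ Set.Icc (0 : ℝ) m, x ≤ |(r + s) * Y k (r + s) ω - r * Y k r ω|}
        ⊆ {ω | ENNReal.ofReal (x * 1) ≤ ⨆ s ∈ Set.Icc (0 : ℝ) m,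
          ENNReal.ofReal |(r + s) * Y k (r + s) ω - r * Y k r ω|} := by
      rintro ω ⟨s, hs, hxs⟩
      rw [Set.mem_ofPred_eq, mul_one]
      exact le_iSup₂_of_le s hs (ENNReal.ofReal_le_ofReal hxs)
    refine (measure_mono hsub).trans ((le_iSup (fun k => P {ω | ENNReal.ofReal (x * 1) ≤
      ⨆ s ∈ Set.Icc (0 : ℝ) m, ENNReal.ofReal |(r + s) * Y k (r + s) ω - r * Y k r ω|}) k).trans
      ((hb x r m hx hr hm).trans (ENNReal.ofReal_le_ofReal ?_)))
    rw [mul_div_assoc, ← Real.div_rpow hm hx.le]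
    exact mul_le_mul (le_max_left _ _) (Real.rpow_le_rpow_of_exponent_ge' (by positivity) hmx
      (le_min (by linarith) (by norm_num)) (min_le_left _ _)) (by positivity) (by positivity)

/-! ### Stability under centring -/

/-- Integrates the tail, bounded by `1` up to level `m` and by the integrable power beyond it;
scaling makes the result linear in `m`. -/
theorem abs_integral_le_of_measure_le_rpow {P : Measure Ω} [IsProbabilityMeasure P] {Z : Ω → ℝ}
    (hZ : Integrable Z P) {β C m : ℝ} (hβ : 1 < β) (hC : 0 ≤ C) (hm : 0 < m)
    (h : ∀ x : ℝ, 0 < x → P {ω | x ≤ |Z ω|} ≤ ENNReal.ofReal (C * (m / x) ^ β)) :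
    |∫ ω, Z ω ∂P| ≤ (1 + C / (β - 1)) * m := by
  have hβ1 : 0 < β - 1 := by linarith
  have hint : IntegrableOn (fun x : ℝ => C * m ^ β * x ^ (-β)) (Set.Ioi m) :=
    (integrableOn_Ioi_rpow_of_lt (by linarith) hm).const_mul _
  have htail : ∫ x in Set.Ioi m, C * m ^ β * x ^ (-β) = C / (β - 1) * m := by
    rw [integral_const_mul, integral_Ioi_rpow_of_lt (by linarith) hm]
    have h1 : m ^ β * m ^ (-β + 1) = m := by
      rw [← Real.rpow_add hm, show β + (-β + 1) = 1 by ring, Real.rpow_one]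
    have h2 : -β + 1 ≠ 0 := by linarith
    calc C * m ^ β * (-m ^ (-β + 1) / (-β + 1)) = C * (m ^ β * m ^ (-β + 1)) / (β - 1) := by
          rw [show -β + 1 = -(β - 1) by ring, neg_div_neg_eq]
          ring
      _ = _ := by rw [h1]; ring
  refine (abs_integral_le_integral_abs).trans ?_
  rw [integral_eq_lintegral_of_nonneg_ae (ae_of_all _ fun ω => abs_nonneg _)
    hZ.abs.aestronglyMeasurable]
  refine ENNReal.toReal_le_of_le_ofReal (by positivity) ?_
  rw [lintegral_eq_lintegral_meas_le P (ae_of_all _ fun ω => abs_nonneg _)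
    hZ.abs.aestronglyMeasurable.aemeasurable, ← Set.Ioc_union_Ioi_eq_Ioi hm.le,
    lintegral_union measurableSet_Ioi (Set.Ioc_disjoint_Ioi le_rfl), add_mul, one_mul,
    ENNReal.ofReal_add hm.le (by positivity), ← htail,
    ofReal_integral_eq_lintegral_ofReal hint]
  · refine add_le_add ?_ ?_
    · calc ∫⁻ x in Set.Ioc 0 m, P {ω | x ≤ |Z ω|} ≤ ∫⁻ _ in Set.Ioc 0 m, 1 :=
            lintegral_mono fun x => prob_le_one
        _ = _ := by simp
    · refine setLIntegral_mono (by fun_prop) fun x hx => ?_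
      have hx0 : 0 < x := hm.trans hx
      refine (h x hx0).trans_eq ?_
      rw [Real.div_rpow hm.le hx0.le, Real.rpow_neg hx0.le]
      congr 1
      ring
  · filter_upwards [ae_restrict_mem measurableSet_Ioi] with x hx
    have hx0 : 0 < x := hm.trans hx
    positivity

section Centred

variable {X : ℕ → ℝ → Ω → ℝ} {P : Measure Ω} [IsProbabilityMeasure P]

/-- Off the event `A`, `|X|` is at most `ε / 3`; on `A`, `|X| ≤ η * X ^ 2 + η⁻¹`. The choice of `η`
makes the quadratic part cost `ε / 3`, and `m₀` then makes `P A` small enough for the rest. -/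
theorem UniformBounds.exists_abs_mean_le (h : UniformBounds X P)
    (hmeas : ∀ (k : ℕ) (m : ℝ), 0 ≤ m → Measurable (X k m)) {ε : ℝ} (hε : 0 < ε) :
    ∃ m₀ : ℝ, 0 < m₀ ∧ ∀ (k : ℕ) (m : ℝ), m₀ ≤ m → |∫ ω, X k m ω ∂P| ≤ ε := by
  obtain ⟨δ, hδ, hdecay⟩ := h.decay
  obtain ⟨V, hV, hmom⟩ := h.secondMoment
  obtain ⟨C, hC, hCb⟩ := hdecay (ε / 3) (by positivity)
  set η := ε / (3 * V) with hη
  have hη0 : 0 < η := by positivity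
  obtain ⟨m₀, hm₀, hm₀'⟩ := ((eventually_gt_atTop (0 : ℝ)).and
    ((tendsto_rpow_atTop hδ).eventually_ge_atTop (C / (η * (ε / 3))))).exists
  refine ⟨m₀, hm₀, fun k m hm => ?_⟩
  have hm0 : 0 < m := hm₀.trans_le hm
  obtain ⟨hL2, hsq⟩ := hmom k m hm0.le
  set A := {ω | ε / 3 < |X k m ω|} with hA
  have hAm : MeasurableSet A := measurableSet_lt measurable_const (hmeas k m hm0.le).abs
  have hPA : P.real A ≤ η * (ε / 3) := by
    refine ENNReal.toReal_le_of_le_ofReal (by positivity)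
      ((hCb k m hm0).trans (ENNReal.ofReal_le_ofReal ?_))
    rw [div_le_iff₀ (by positivity)]
    rw [div_le_iff₀ (by positivity), mul_comm] at hm₀'
    refine hm₀'.trans ?_
    gcongr
  have hsqi : Integrable (fun ω => ε / 3 + η * X k m ω ^ 2) P :=
    (integrable_const _).add (hL2.integrable_sq.const_mul _)
  have hindi : Integrable (A.indicator fun _ => η⁻¹) P := (integrable_const _).indicator hAm
  calc |∫ ω, X k m ω ∂P| ≤ ∫ ω, |X k m ω| ∂P := abs_integral_le_integral_abs
    _ ≤ ∫ ω, (ε / 3 + η * X k m ω ^ 2 + A.indicator (fun _ => η⁻¹) ω) ∂P := by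
        refine integral_mono (hL2.integrable (by norm_num)).abs
          (hsqi.add hindi) fun ω => ?_
        simp only
        by_cases hω : ω ∈ A
        · rw [Set.indicator_of_mem hω]
          have h1 : η * |X k m ω| ^ 2 + η⁻¹ - |X k m ω|
              = η * (|X k m ω| - η⁻¹ / 2) ^ 2 + 3 / 4 * η⁻¹ := by
            field_simp
            ring
          have h2 : 0 ≤ η * (|X k m ω| - η⁻¹ / 2) ^ 2 + 3 / 4 * η⁻¹ := by positivity
          rw [sq_abs] at h1
          linarith
        · rw [Set.indicator_of_notMem hω]
          have h1 : |X k m ω| ≤ ε / 3 := not_lt.1 hω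
          have h2 : 0 ≤ η * X k m ω ^ 2 := by positivity
          linarith
    _ = ε / 3 + η * ∫ ω, X k m ω ^ 2 ∂P + P.real A * η⁻¹ := by
        rw [integral_add hsqi hindi,
          integral_add (integrable_const _) (hL2.integrable_sq.const_mul _),
          integral_const_mul, integral_indicator_const _ hAm]
        simp
    _ ≤ ε / 3 + η * V + η * (ε / 3) * η⁻¹ := by gcongr
    _ = ε := by rw [hη]; field_simp; ring

/-- Centring thus shifts increments by a deterministic `O(m)`, negligible at levels `x` well above
`m`. -/
theorem UniformBounds.exists_abs_mean_increment_le (h : UniformBounds X P)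
    (hint : ∀ (k : ℕ) (m : ℝ), 0 ≤ m → Integrable (X k m) P) :
    ∃ K : ℝ, 1 ≤ K ∧ ∀ (k : ℕ) (r m : ℝ), 0 < r → 0 ≤ m → ∀ s ∈ Set.Icc (0 : ℝ) m,
      |(r + s) * ∫ ω, X k (r + s) ω ∂P - r * ∫ ω, X k r ω ∂P| ≤ K * m := by
  obtain ⟨β, C, hβ, -, hC, hinc⟩ := h.increment
  refine ⟨1 + C / (β - 1), ?_, fun k r m hr hm s hs => ?_⟩
  · have : 0 ≤ C / (β - 1) := div_nonneg (by linarith) (by linarith)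
    linarith
  rcases hm.eq_or_lt with rfl | hm
  · have : s = 0 := le_antisymm hs.2 hs.1
    simp [this]
  have h1 := (hint k (r + s) (by linarith [hs.1])).const_mul (r + s)
  have h2 := (hint k r hr.le).const_mul r
  rw [← integral_const_mul, ← integral_const_mul, ← integral_sub h1 h2]
  exact abs_integral_le_of_measure_le_rpow (h1.sub h2) hβ (by linarith) hm fun x hx =>
    (measure_mono (t := {ω | ∃ s ∈ Set.Icc (0 : ℝ) m,
      x ≤ |(r + s) * X k (r + s) ω - r * X k r ω|}) fun ω hω => ⟨s, hs, hω⟩).trans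
      (hinc k r m x hr hm.le hx)

theorem UniformBounds.centred (h : UniformBounds X P)
    (hmeas : ∀ (k : ℕ) (m : ℝ), 0 ≤ m → Measurable (X k m))
    (hint : ∀ (k : ℕ) (m : ℝ), 0 ≤ m → Integrable (X k m) P) :
    UniformBounds (centred X P) P := by
  refine ⟨?_, ?_, ?_⟩
  · obtain ⟨δ, hδ, hdecay⟩ := h.decay
    refine ⟨δ, hδ, fun ε hε => ?_⟩
    obtain ⟨C, hC, hCb⟩ := hdecay (ε / 2) (by positivity)
    obtain ⟨m₀, hm₀, hmean⟩ := h.exists_abs_mean_le hmeas (show 0 < ε / 2 by positivity)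
    -- The entry `m₀ ^ δ` makes the bound trivial for `m ≤ m₀`, where the mean need not be small.
    refine ⟨max C (m₀ ^ δ), by positivity, fun k m hm => ?_⟩
    rcases le_total m₀ m with hmm | hmm
    · refine (measure_mono (t := {ω | ε / 2 < |X k m ω|}) fun ω hω => ?_).trans
        ((hCb k m hm).trans (ENNReal.ofReal_le_ofReal ?_))
      · have h1 : ε < |X k m ω - ∫ ω', X k m ω' ∂P| := hω
        have h2 := abs_sub (X k m ω) (∫ ω', X k m ω' ∂P)
        rw [Set.mem_ofPred_eq]
        linarith [hmean k m hmm]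
      · gcongr
        exact le_max_left _ _
    · refine prob_le_one.trans ?_
      rw [← ENNReal.ofReal_one]
      refine ENNReal.ofReal_le_ofReal ?_
      rw [le_div_iff₀ (by positivity), one_mul]
      exact (Real.rpow_le_rpow hm.le hmm hδ.le).trans (le_max_right _ _)
  · obtain ⟨V, hV, hmom⟩ := h.secondMoment
    refine ⟨V, hV, fun k m hm => ⟨(hmom k m hm).1.sub (memLp_const _), ?_⟩⟩
    have h1 := variance_le_expectation_sq (μ := P) (X := X k m)
      (hmeas k m hm).aestronglyMeasurable
    rw [variance_eq_integral (hmeas k m hm).aemeasurable] at h1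
    exact h1.trans (hmom k m hm).2
  · obtain ⟨K, hK, hmean⟩ := h.exists_abs_mean_increment_le hint
    obtain ⟨β, C, hβ, hβ2, hC, hinc⟩ := h.increment
    have hpow : (1 : ℝ) ≤ (2 * K) ^ β := Real.one_le_rpow (by linarith) (by linarith)
    -- The factor `2 * K` ensures that in the nontrivial range the mean shift `K * m` is at most `x
    -- / 2`.
    refine ⟨β, C * (2 * K) ^ β, hβ, hβ2, by nlinarith, fun k r m x hr hm hx =>
      prob_le_of_le_one fun hle => ?_⟩
    rw [mul_assoc, ← Real.mul_rpow (by linarith) (by positivity)] at hle ⊢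
    have hKm : 2 * K * (m / x) ≤ 1 := by
      by_contra! hlt
      have := Real.one_lt_rpow hlt (show 0 < β by linarith)
      nlinarith
    have hKm' : 2 * (K * m) ≤ x := by
      rw [← mul_div_assoc, div_le_one hx] at hKm
      linarith
    refine (measure_mono (t := {ω | ∃ s ∈ Set.Icc (0 : ℝ) m,
      x / 2 ≤ |(r + s) * X k (r + s) ω - r * X k r ω|}) ?_).trans
      ((hinc k r m (x / 2) hr hm (by positivity)).trans (ENNReal.ofReal_le_ofReal ?_))
    · rintro ω ⟨s, hs, hxs⟩
      refine ⟨s, hs, ?_⟩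
      have h1 := hmean k r m hr hm s hs
      have h2 := abs_sub ((r + s) * X k (r + s) ω - r * X k r ω)
        ((r + s) * ∫ ω, X k (r + s) ω ∂P - r * ∫ ω, X k r ω ∂P)
      have h3 : (r + s) * GameOfMass.centred X P k (r + s) ω - r * GameOfMass.centred X P k r ω
          = ((r + s) * X k (r + s) ω - r * X k r ω)
            - ((r + s) * ∫ ω, X k (r + s) ω ∂P - r * ∫ ω, X k r ω ∂P) := by
        simp only [GameOfMass.centred]
        ring
      rw [h3] at hxs
      linarith
    · gcongr
      have : 0 ≤ m / x := by positivity
      calc m / (x / 2) = 2 * 1 * (m / x) := by field_simp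
        _ ≤ _ := by gcongr

end Centred

theorem gradualSum_centred {X : ℕ → ℝ → Ω → ℝ} {P : Measure Ω} {m : ℕ → ℝ} (hm : ∀ k, 0 ≤ m k)
    (hint : ∀ (k : ℕ) (m : ℝ), 0 ≤ m → Integrable (X k m) P) {t : ℝ} (ht : 0 < t) (ω : Ω) :
    gradualSum (centred X P) m t ω = gradualSum X m t ω - ∫ ω', gradualSum X m t ω' ∂P := by
  have h1 : ∀ k, Integrable (fun ω' => m k / t * X k (m k) ω') P := fun k =>
    (hint k _ (hm k)).const_mul _
  simp only [gradualSum]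
  rw [integral_add (integrable_finsetSum _ fun k _ => h1 k)
    ((hint _ _ (remTime_pos ht).le).const_mul _), integral_finsetSum _ fun k _ => h1 k]
  simp only [centred, integral_const_mul, mul_sub, Finset.sum_sub_distrib]
  ring

end GameOfMass

theorem mainTheorem4 {Ω : Type*} [MeasurableSpace Ω] (P : Measure Ω) [IsProbabilityMeasure P]
    (X : ℕ → ℝ → Ω → ℝ)
    (hmeas : ∀ (k : ℕ) (m : ℝ), 0 ≤ m → Measurable (X k m))
    (hint : ∀ (k : ℕ) (m : ℝ), 0 ≤ m → Integrable (X k m) P)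
    (hindep : ∀ m : ℕ → ℝ, (∀ k, 0 ≤ m k) → iIndepFun (fun k => X k (m k)) P)
    (hS : GameOfMass.SatisfiesS X P ∨ GameOfMass.SatisfiesS (GameOfMass.centred X P) P)
    (m : ℕ → ℝ) (hm : ∀ k, 0 ≤ m k)
    (hdiv : Tendsto (GameOfMass.cumMass m) atTop atTop)
    (t : ℕ → ℝ) (ht : Monotone t) (htop : Tendsto t atTop atTop)
    (v : ℝ)
    (hv : Tendsto (fun j => ∫ ω, GameOfMass.gradualSum X m (t j) ω ∂P) atTop (𝓝 v)) :
    ∀ᵐ ω ∂P, Tendsto (fun j => GameOfMass.gradualSum X m (t j) ω) atTop (𝓝 v) := by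
  have hcmeas : ∀ (k : ℕ) (m : ℝ), 0 ≤ m → Measurable (GameOfMass.centred X P k m) :=
    fun k m hm => (hmeas k m hm).sub_const _
  have hb : GameOfMass.UniformBounds (GameOfMass.centred X P) P := by
    rcases hS with hS | hS
    · exact (GameOfMass.SatisfiesS.uniformBounds hmeas hS).centred hmeas hint
    · exact GameOfMass.SatisfiesS.uniformBounds hcmeas hS
  have hmean : ∀ k, ∫ ω, GameOfMass.centred X P k (m k) ω ∂P = 0 := fun k => by
    simp only [GameOfMass.centred]
    rw [integral_sub (hint k _ (hm k)) (integrable_const _)]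
    simp
  have hlim := hb.ae_tendsto_gradualSum hm hdiv (fun k => hcmeas k _ (hm k)) hmean
    ((hindep m hm).comp (fun k x => x - ∫ ω, X k (m k) ω ∂P) fun k => measurable_id.sub_const _)
  filter_upwards [hlim] with ω hω
  have h1 := (hω.comp htop).add hv
  rw [zero_add] at h1
  refine h1.congr' ?_
  filter_upwards [htop.eventually_gt_atTop 0] with j hj
  simp only [Function.comp_apply]
  rw [GameOfMass.gradualSum_centred hm hint hj]
  ring
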